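/- Throughout, a Leibniz algebra over a field $F$ is a finite-dimensional $F$-vector space $A$ with a bilinear multiplication satisfying the left Leibniz identity $x(yz) = (xy)z + y(xz)$ for all $x,y,z\in A$ (that is, every left multiplication is a derivation). For a subspace $I$ contained in a subalgebra $C$ of $A$ write $I \vartriangleleft C$ if $xy, yx \in I$ for all $x\in C$, $y\in I$; an ideal of $A$ is an $I \vartriangleleft A$. For a subalgebra $B$ put $B^1 = B$ and $B^{i+1} = BB^{i}$ (the linear span of the products); $B$ is nilpotent if $B^m = \{0\}$ for some $m\ge 1$. Let $\mathrm{nilrad}(A)$ be the sum of all nilpotent ideals of $A$, which is the largest nilpotent ideal of $A$. A subalgebra $B$ is subinvariant in $A$ if there is a chain of subalgebras $B = B_t \subseteq B_{t-1} \subseteq \cdots \subseteq B_0 = A$, $t \ge 0$, with $B_{i} \vartriangleleft B_{i-1}$ for $1\le i\le t$. Theorem. (1) Let $F$ be a field of characteristic zero, $A$ a Leibniz algebra over $F$, and $M$ a nilpotent subinvariant subalgebra of $A$. Then $M \subseteq \mathrm{nilrad}(A)$. (2) This fails in characteristic $p>2$: for every prime $p>2$ and every field $F$ of characteristic $p$ there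 are a Leibniz algebra $P$ over $F$ (which can be taken to be a Lie algebra, i.e. $x x = 0$ for all $x \in P$) with $\mathrm{nilrad}(P) = \{0\}$ and a nilpotent subinvariant subalgebra $M$ of $P$ with $M \not\subseteq \mathrm{nilrad}(P)$. -/

import Mathlib

universe u v

/-- A (not necessarily associative) ring is *left Leibniz* if every left multiplication
`L_x : y ↦ x * y` is a derivation. A Leibniz algebra over a field `F` is a finite-dimensional
`F`-vector space with a bilinear multiplication satisfying this identity; bilinearity over `F` is
expressed by `[IsScalarTower F A A] [SMulCommClass F A A]`. -/
class IsLeftLeibniz (A : Type*) [NonUnitalNonAssocRing A] : Prop where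
  leibniz : ∀ x y z : A, x * (y * z) = (x * y) * z + y * (x * z)

namespace LeibnizAlg

variable {F A : Type*} [Field F] [NonUnitalNonAssocRing A] [Module F A]

/-- `I` is a (two-sided) ideal of `C`, where `C` is a subalgebra of `A`
(`C = ⊤` gives the ideals of `A`). -/
def IsIdealOf (I C : Submodule F A) : Prop :=
  I ≤ C ∧ ∀ x ∈ C, ∀ y ∈ I, x * y ∈ I ∧ y * x ∈ I

theorem isIdealOf_sup {I J : Submodule F A} (hI : IsIdealOf I ⊤) (hJ : IsIdealOf J ⊤) :
    IsIdealOf (I ⊔ J) ⊤ := by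
  refine ⟨le_top, fun x hx y hy => ?_⟩
  obtain ⟨a, ha, b, hb, rfl⟩ := Submodule.mem_sup.1 hy
  rw [mul_add, add_mul]
  exact ⟨Submodule.add_mem_sup (hI.2 x hx a ha).1 (hJ.2 x hx b hb).1,
    Submodule.add_mem_sup (hI.2 x hx a ha).2 (hJ.2 x hx b hb).2⟩

variable [IsScalarTower F A A] [SMulCommClass F A A]

/-- A subalgebra `B` of `A` is subinvariant if there is a chain of subalgebras
`B = B_t ⊂ ... ⊂ B_1 ⊂ B_0 = A` in which each `B_{i+1}` is an ideal of `B_i`. -/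
def IsSubinvariant (B : NonUnitalSubalgebra F A) : Prop :=
  ∃ (t : ℕ) (c : ℕ → NonUnitalSubalgebra F A), c 0 = ⊤ ∧ c t = B ∧
    ∀ i < t, IsIdealOf (c (i + 1)).toSubmodule (c i).toSubmodule

/-- The linear span `UV` of all products `u * v` with `u ∈ U` and `v ∈ V`. -/
def prod (U V : Submodule F A) : Submodule F A :=
  Submodule.map₂ (LinearMap.mul F A) U V

/-- The lower central series of a subalgebra `U` (shifted by one):
`lcs U 0 = U` and `lcs U (i + 1) = U (lcs U i)`, so that `lcs U i` is the power `U^(i+1)`. -/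
def lcs (U : Submodule F A) : ℕ → Submodule F A
  | 0 => U
  | i + 1 => prod U (lcs U i)

/-- A subalgebra is nilpotent if some term of its lower central series vanishes. -/
def IsNilp (U : Submodule F A) : Prop := ∃ m : ℕ, lcs U m = ⊥

variable (F A) in
/-- The set of nilpotent ideals of `A`. -/
def nilpotentIdeals : Set (Submodule F A) := {I | IsIdealOf I ⊤ ∧ IsNilp I}

variable (F A) in
/-- The nilradical of `A`: the sum of all nilpotent ideals. By `isGreatest_nilrad` below it is the
largest nilpotent ideal of a finite-dimensional left Leibniz algebra. -/
def nilrad : Submodule F A := sSup (nilpotentIdeals F A)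

theorem prod_le {U V W : Submodule F A} : prod U V ≤ W ↔ ∀ x ∈ U, ∀ y ∈ V, x * y ∈ W :=
  Submodule.map₂_le

theorem mul_mem_prod {U V : Submodule F A} {x y : A} (hx : x ∈ U) (hy : y ∈ V) :
    x * y ∈ prod U V := Submodule.apply_mem_map₂ (LinearMap.mul F A) hx hy

/-- `ipow I k` is the power `I^k` of an ideal, with `I^0 = A`. -/
def ipow (I : Submodule F A) : ℕ → Submodule F A
  | 0 => ⊤
  | k + 1 => lcs I k

theorem mul_mem_ipow_succ {I : Submodule F A} (hI : IsIdealOf I ⊤) {x y : A} (hx : x ∈ I) :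
    ∀ k, y ∈ ipow I k → x * y ∈ ipow I (k + 1)
  | 0, _ => (hI.2 y trivial x hx).2
  | _ + 1, hy => mul_mem_prod hx hy

theorem mul_mem_lcs [IsLeftLeibniz A] {I : Submodule F A} (hI : IsIdealOf I ⊤) (x : A) :
    ∀ k y, y ∈ lcs I k → x * y ∈ lcs I k
  | 0, y, hy => (hI.2 x trivial y hy).1
  | k + 1, y, hy => by
    have h : prod I (lcs I k) ≤ (prod I (lcs I k)).comap (LinearMap.mulLeft F x) := by
      refine prod_le.2 fun u hu v hv => ?_
      simp only [Submodule.mem_comap, LinearMap.mulLeft_apply]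
      rw [IsLeftLeibniz.leibniz]
      exact add_mem (mul_mem_prod (hI.2 x trivial u hu).1 hv)
        (mul_mem_prod hu (mul_mem_lcs hI x k v hv))
    exact h hy

theorem mul_mem_ipow [IsLeftLeibniz A] {I : Submodule F A} (hI : IsIdealOf I ⊤) (x : A) {y : A} :
    ∀ k, y ∈ ipow I k → x * y ∈ ipow I k
  | 0, _ => trivial
  | k + 1, hy => mul_mem_lcs hI x k y hy

theorem lcs_eq_bot_of_le {U : Submodule F A} {m : ℕ} (h : lcs U m = ⊥) (d : ℕ) :
    lcs U (m + d) = ⊥ := by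
  induction d with
  | zero => exact h
  | succ d ih =>
    change prod U (lcs U (m + d)) = ⊥
    rw [ih]
    exact Submodule.map₂_bot_right _ _

theorem isNilp_sup [IsLeftLeibniz A] {I J : Submodule F A} (hI : IsIdealOf I ⊤)
    (hJ : IsIdealOf J ⊤) (nI : IsNilp I) (nJ : IsNilp J) : IsNilp (I ⊔ J) := by
  have key : ∀ n, lcs (I ⊔ J) n ≤
      ⨆ q : {q : ℕ × ℕ // q.1 + q.2 = n + 1}, ipow I q.1.1 ⊓ ipow J q.1.2 := by
    intro n
    induction n with
    | zero =>
      refine sup_le ?_ ?_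
      · exact le_iSup_of_le ⟨(1, 0), rfl⟩ (le_inf le_rfl le_top)
      · exact le_iSup_of_le ⟨(0, 1), rfl⟩ (le_inf le_top le_rfl)
    | succ n ih =>
      refine prod_le.2 fun x hx y hy => ?_
      obtain ⟨a, ha, b, hb, rfl⟩ := Submodule.mem_sup.1 hx
      have h : (⨆ q : {q : ℕ × ℕ // q.1 + q.2 = n + 1}, ipow I q.1.1 ⊓ ipow J q.1.2) ≤
          (⨆ q : {q : ℕ × ℕ // q.1 + q.2 = n + 1 + 1}, ipow I q.1.1 ⊓ ipow J q.1.2).comap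
            (LinearMap.mulLeft F (a + b)) := by
        refine iSup_le fun ⟨⟨k, l⟩, hkl⟩ z hz => ?_
        simp only [Submodule.mem_comap, LinearMap.mulLeft_apply, add_mul]
        simp only at hkl
        refine add_mem ?_ ?_
        · refine Submodule.mem_iSup_of_mem ⟨(k + 1, l), by simp only; omega⟩ ?_
          exact ⟨mul_mem_ipow_succ hI ha k hz.1, mul_mem_ipow hJ a l hz.2⟩
        · refine Submodule.mem_iSup_of_mem ⟨(k, l + 1), by simp only; omega⟩ ?_
          exact ⟨mul_mem_ipow hI b k hz.1, mul_mem_ipow_succ hJ hb l hz.2⟩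
      exact h (ih hy)
  obtain ⟨m, hm⟩ := nI
  obtain ⟨m', hm'⟩ := nJ
  refine ⟨m + m' + 1, le_bot_iff.1 ((key _).trans (iSup_le ?_))⟩
  rintro ⟨⟨k, l⟩, hkl⟩
  simp only at hkl ⊢
  rcases Nat.lt_or_ge m k with h | h
  · obtain ⟨d, rfl⟩ := Nat.exists_eq_add_of_lt h
    exact inf_le_left.trans (lcs_eq_bot_of_le hm d).le
  · obtain ⟨d, rfl⟩ := Nat.exists_eq_add_of_lt (show m' < l by omega)
    exact inf_le_right.trans (lcs_eq_bot_of_le hm' d).le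

theorem bot_mem_nilpotentIdeals : (⊥ : Submodule F A) ∈ nilpotentIdeals F A := by
  refine ⟨⟨bot_le, fun x _ y hy => ?_⟩, 0, rfl⟩
  rw [(Submodule.mem_bot F).1 hy]
  simp

variable (F A) in
/-- The nilradical is the largest nilpotent ideal, over any field. -/
theorem isGreatest_nilrad [IsLeftLeibniz A] [FiniteDimensional F A] :
    IsGreatest (nilpotentIdeals F A) (nilrad F A) := by
  refine ⟨?_, fun I hI => le_sSup hI⟩
  obtain ⟨N, hN, hmax⟩ :=
    (wellFounded_gt (α := Submodule F A)).has_min (nilpotentIdeals F A)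
      ⟨⊥, bot_mem_nilpotentIdeals⟩
  have h : nilrad F A = N := by
    refine le_antisymm (sSup_le fun I hI => ?_) (le_sSup hN)
    by_contra hle
    exact hmax (N ⊔ I) ⟨isIdealOf_sup hN.1 hI.1, isNilp_sup hN.1 hI.1 hN.2 hI.2⟩
      (left_lt_sup.2 hle)
  rw [h]
  exact hN

end LeibnizAlg

/-!
In characteristic zero it suffices to show that a nilpotent ideal `N` of an ideal `C` of `A` lies
in a nilpotent ideal of `A`, and to apply this along the chain (`le_nilrad_of_isSubinvariant`).
Take `N` maximal among the nilpotent ideals of `C` (`exists_nilpotent_ideal_of_ideal`).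

* For `a ∈ A` the subspace `N + aN` is an ideal of `C`. It is nilpotent (`isNilp_sup_map_mul`):
  in the associative algebra generated by the left multiplications by elements of `C`, those by
  elements of `N` generate a nilpotent ideal, and left multiplication by `a n` is the commutator of
  the left multiplications by `a` and `n`. In characteristic zero, a nilpotent ideal stays nilpotent
  after adding its image under a derivation `δ` (`sup_map_pow_le_of_filtration`), because
  `0 = δ ^ m (z₁ ⋯ zₘ)` equals `m! δ z₁ ⋯ δ zₘ` modulo the ideal. By maximality `aN ⊆ N`.
* The elements `n a + a n` act as zero from the left, so `N + NA` has the same left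
  multiplications as `N`. It is therefore a nilpotent ideal of `C` too (`isNilp_sup_prod_top`,
  `isIdealOf_sup_prod_top`), and `NA ⊆ N`.

In characteristic `p`, let `R = F[X] / (X ^ p)`, on which `d = d/dX` is a well-defined derivation
without nontrivial stable ideals, and let `P = R³ ⋊ F d` with the cross product on `R³`. A nonzero
ideal of `P` contains the unit vectors (`CrossDer.nilrad_eq_bot`), whose products are again unit
vectors up to sign, so it is not nilpotent. But `(X)³` is a nonzero nilpotent ideal of the ideal
`R³` of `P`. The cross product is a simple Lie algebra over every field, which makes it more
convenient here than `𝔰𝔩₂`.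
-/

namespace LeibnizAlg

/-! ### Derivations and multiplicative filtrations of associative algebras -/

section Associative

variable {F E : Type*} [Field F] [Ring E] [Algebra F E]

theorem iterate_apply_mem_filtration {δ : E →ₗ[F] E} {I : ℕ → Submodule F E}
    (hd : ∀ k, ∀ x ∈ I k, δ x ∈ I (k - 1)) (j k : ℕ) {w : E} (hw : w ∈ I k) :
    (δ ^ j) w ∈ I (k - j) := by
  induction j with
  | zero => exact hw
  | succ j ih =>
    rw [pow_succ', Module.End.mul_apply, ← Nat.sub_sub]
    exact hd _ _ ih

/-- Modulo terms of higher degree only two summands of the Leibniz expansion of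
`δ ^ (j + 1) (z * w)` survive when `z` has degree one, since `δ ^ i z` with `i ≥ 2` lowers the
degree of `z` by at most one while costing `i` of the available applications of `δ`. -/
theorem iterate_mul_sub_mem_filtration {δ : E →ₗ[F] E}
    (hδ : ∀ x y, δ (x * y) = δ x * y + x * δ y) {I : ℕ → Submodule F E}
    (hmul : ∀ k l, ∀ x ∈ I k, ∀ y ∈ I l, x * y ∈ I (k + l))
    (hd : ∀ k, ∀ x ∈ I k, δ x ∈ I (k - 1)) {k : ℕ} {z w : E} (hz : z ∈ I 1) (hw : w ∈ I k)
    (j : ℕ) (hj : j ≤ k) :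
    (δ ^ (j + 1)) (z * w) - z * (δ ^ (j + 1)) w - ((j : F) + 1) • (δ z * (δ ^ j) w)
      ∈ I (k - j + 1) := by
  induction j with
  | zero => simp [hδ]
  | succ j ih =>
    have h1 := hd _ _ (ih (by omega))
    have h2 : δ (δ z) * (δ ^ j) w ∈ I (k - (j + 1) + 1) := by
      have := hmul _ _ _ (hd _ _ (hd _ _ hz)) _ (iterate_apply_mem_filtration hd j k hw)
      convert this using 2
      omega
    have e : k - j + 1 - 1 = k - (j + 1) + 1 := by omega
    rw [e] at h1
    have := add_mem h1 (Submodule.smul_mem _ ((j : F) + 1) h2)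
    convert this using 1
    simp only [pow_succ' δ, Module.End.mul_apply, map_sub, map_smul, hδ, smul_add]
    push_cast
    module

/-- In characteristic zero the first term of a multiplicative filtration, enlarged by its image
under a derivation `δ` lowering degrees by at most one, is still nilpotent modulo that first term:
expanding `δ ^ m (z₁ ⋯ zₘ) = 0` gives `m! • (δ z₁ ⋯ δ zₘ) ∈ I 1`. -/
theorem sup_map_pow_le_of_filtration [CharZero F] {δ : E →ₗ[F] E}
    (hδ : ∀ x y, δ (x * y) = δ x * y + x * δ y) {I : ℕ → Submodule F E} (h1 : 1 ∈ I 0)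
    (hanti : Antitone I) (hmul : ∀ k l, ∀ x ∈ I k, ∀ y ∈ I l, x * y ∈ I (k + l))
    (hd : ∀ k, ∀ x ∈ I k, δ x ∈ I (k - 1)) {m : ℕ} (hm : I m = ⊥) :
    (I 1 ⊔ (I 1).map δ) ^ m ≤ I 1 := by
  have h01 : I 0 * I 1 ≤ I 1 := Submodule.mul_le.2 fun x hx y hy => by
    simpa using hmul 0 1 x hx y hy
  have h10 : I 1 * I 0 ≤ I 1 := Submodule.mul_le.2 fun x hx y hy => by
    simpa using hmul 1 0 x hx y hy
  have hJ : (I 1).map δ ≤ I 0 := Submodule.map_le_iff_le_comap.2 fun x hx => hd 1 x hx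
  have h1' : (1 : Submodule F E) ≤ I 0 := Submodule.one_le.2 h1
  have hJk : ∀ k, ((I 1).map δ) ^ k ≤ I 0 := fun k => by
    induction k with
    | zero => simpa using h1'
    | succ k ih =>
      rw [pow_succ']
      exact (mul_le_mul' hJ ih).trans (Submodule.mul_le.2 fun x hx y hy => hmul 0 0 x hx y hy)
  -- products with a factor in `I 1` lie in `I 1`, so only products of derivatives matter
  have hA : ∀ k, (I 1 ⊔ (I 1).map δ) ^ k ≤ I 1 ⊔ ((I 1).map δ) ^ k := fun k => by
    induction k with
    | zero => simp
    | succ k ih =>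
      rw [pow_succ']
      refine (mul_le_mul' le_rfl ih).trans ?_
      rw [Submodule.sup_mul, Submodule.mul_sup, Submodule.mul_sup, pow_succ']
      refine sup_le (le_sup_of_le_left (sup_le ?_ ?_)) (sup_le (le_sup_of_le_left ?_) le_sup_right)
      · exact (mul_le_mul' (hanti zero_le_one) le_rfl).trans h01
      · exact (mul_le_mul' le_rfl (hJk k)).trans h10
      · exact (mul_le_mul' hJ le_rfl).trans h01
  -- `δ z₁ ⋯ δ zₖ` is `δ ^ k (z₁ ⋯ zₖ) / k!` modulo `I 1`
  have hB : ∀ k, ((I 1).map δ) ^ k ≤ I 1 ⊔ (I k).map (δ ^ k) := fun k => by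
    induction k with
    | zero => exact le_sup_of_le_right (by simpa using h1')
    | succ k ih =>
      rw [pow_succ']
      refine (mul_le_mul' le_rfl ih).trans ?_
      rw [Submodule.mul_sup]
      refine sup_le (le_sup_of_le_left ((mul_le_mul' hJ le_rfl).trans h01)) ?_
      rw [Submodule.mul_le]
      rintro _ ⟨z, hz, rfl⟩ _ ⟨w, hw, rfl⟩
      have key := iterate_mul_sub_mem_filtration hδ hmul hd hz hw k le_rfl
      have hzw : z * (δ ^ (k + 1)) w ∈ I 1 := by
        have := hmul _ _ _ hz _ (iterate_apply_mem_filtration hd (k + 1) k hw)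
        convert this using 2
        omega
      have hk : ((k : F) + 1) ≠ 0 := by exact_mod_cast Nat.succ_ne_zero k
      rw [Nat.sub_self, zero_add] at key
      have hs := Submodule.smul_mem (I 1) ((k : F) + 1)⁻¹ (neg_mem (add_mem key hzw))
      have ht : (δ ^ (k + 1)) (((k : F) + 1)⁻¹ • (z * w)) ∈ (I (k + 1)).map (δ ^ (k + 1)) :=
        Submodule.mem_map_of_mem
          (Submodule.smul_mem _ _ (by rw [add_comm k 1]; exact hmul _ _ _ hz _ hw))
      convert Submodule.add_mem_sup hs ht using 1
      rw [map_smul, ← smul_add, eq_inv_smul_iff₀ hk]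
      abel
  refine (hA m).trans (sup_le le_rfl ((hB m).trans ?_))
  simp [hm]

end Associative

/-! ### Left multiplications and nilpotency -/

section Leibniz

variable {F A : Type*} [Field F] [NonUnitalNonAssocRing A] [Module F A]
  [IsScalarTower F A A] [SMulCommClass F A A]

theorem lcs_le_map₂_pow (U : Submodule F A) (k : ℕ) :
    lcs U k ≤ Submodule.map₂ (LinearMap.id : Module.End F A →ₗ[F] Module.End F A)
      ((U.map (LinearMap.mul F A)) ^ k) ⊤ := by
  induction k with
  | zero =>
    intro y _
    exact Submodule.apply_mem_map₂ (LinearMap.id : Module.End F A →ₗ[F] Module.End F A)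
      (m := 1) (by rw [pow_zero]; exact Submodule.one_le.1 le_rfl) (n := y) trivial
  | succ k ih =>
    refine prod_le.2 fun x hx y hy => ?_
    have h : Submodule.map₂ (LinearMap.id : Module.End F A →ₗ[F] Module.End F A)
        ((U.map (LinearMap.mul F A)) ^ k) ⊤ ≤
        (Submodule.map₂ (LinearMap.id : Module.End F A →ₗ[F] Module.End F A)
          ((U.map (LinearMap.mul F A)) ^ (k + 1)) ⊤).comap (LinearMap.mul F A x) := by
      refine Submodule.map₂_le.2 fun T hT v _ => ?_
      rw [pow_succ']
      exact Submodule.apply_mem_map₂ (LinearMap.id : Module.End F A →ₗ[F] Module.End F A)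
        (Submodule.mul_mem_mul (Submodule.mem_map_of_mem hx) hT) (n := v) trivial
    exact h (ih hy)

/-- A subspace is nilpotent as soon as the products of sufficiently many of its left
multiplications vanish. -/
theorem isNilp_of_pow_eq_bot {U : Submodule F A} {k : ℕ}
    (h : (U.map (LinearMap.mul F A)) ^ k = ⊥) : IsNilp U :=
  ⟨k, le_bot_iff.1 ((lcs_le_map₂_pow U k).trans (by rw [h, Submodule.map₂_bot_left]))⟩

theorem apply_mem_lcs {N : Submodule F A} {W : Submodule F (Module.End F A)}
    (hW : ∀ T ∈ W, ∀ y, T y ∈ N) (k : ℕ) :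
    ∀ T ∈ (N.map (LinearMap.mul F A)) ^ k * W, ∀ y, T y ∈ lcs N k := by
  induction k with
  | zero =>
    rw [pow_zero, one_mul]
    exact hW
  | succ k ih =>
    intro T hT y
    rw [pow_succ', mul_assoc] at hT
    have h : (N.map (LinearMap.mul F A)) * ((N.map (LinearMap.mul F A)) ^ k * W) ≤
        (lcs N (k + 1)).comap (LinearMap.applyₗ y) := by
      refine Submodule.mul_le.2 ?_
      rintro _ ⟨n, hn, rfl⟩ T' hT'
      exact mul_mem_prod hn (ih T' hT' y)
    exact h hT

/-! ### The filtration of the operators attached to a nilpotent ideal -/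

variable (F) in
/-- The associative unital algebra of operators generated by the left multiplications by
elements of `C`. -/
def leftOps (C : Submodule F A) : Submodule F (Module.End F A) :=
  Subalgebra.toSubmodule (Algebra.adjoin F (LinearMap.mul F A '' C))

/-- The products of operators in `leftOps C` with at least `k` factors that are left
multiplications by elements of `N`; when `N` is an ideal of `C` these factors can be moved to
the front. -/
def opFiltration (N C : Submodule F A) (k : ℕ) : Submodule F (Module.End F A) :=
  (N.map (LinearMap.mul F A)) ^ k * leftOps F C

theorem leftOps_mul_self (C : Submodule F A) : leftOps F C * leftOps F C = leftOps F C :=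
  Subalgebra.isIdempotentElem_toSubmodule _

theorem one_mem_leftOps (C : Submodule F A) : (1 : Module.End F A) ∈ leftOps F C :=
  one_mem (Algebra.adjoin F (LinearMap.mul F A '' (C : Set A)))

theorem mul_mem_leftOps {C : Submodule F A} {x : A} (hx : x ∈ C) :
    LinearMap.mul F A x ∈ leftOps F C :=
  Algebra.subset_adjoin (Set.mem_image_of_mem _ hx)

theorem map_mul_le_leftOps {N C : Submodule F A} (h : N ≤ C) :
    N.map (LinearMap.mul F A) ≤ leftOps F C := by
  rintro _ ⟨n, hn, rfl⟩
  exact mul_mem_leftOps (h hn)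

theorem mul_mul_eq [IsLeftLeibniz A] (x y : A) :
    LinearMap.mul F A x * LinearMap.mul F A y =
      LinearMap.mul F A (x * y) + LinearMap.mul F A y * LinearMap.mul F A x := by
  ext z
  simp [IsLeftLeibniz.leibniz x y z]

theorem leftOps_mul_le [IsLeftLeibniz A] {N C : Submodule F A} (hN : IsIdealOf N C) :
    leftOps F C * N.map (LinearMap.mul F A) ≤ N.map (LinearMap.mul F A) * leftOps F C := by
  refine Submodule.mul_le.2 fun r hr => ?_
  induction hr using Algebra.adjoin_induction with
  | mem r hr =>
    obtain ⟨x, hx, rfl⟩ := hr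
    rintro _ ⟨n, hn, rfl⟩
    rw [mul_mul_eq]
    refine add_mem ?_ (Submodule.mul_mem_mul (Submodule.mem_map_of_mem hn) (mul_mem_leftOps hx))
    simpa using Submodule.mul_mem_mul
      (Submodule.mem_map_of_mem (f := LinearMap.mul F A) (hN.2 x hx n hn).1) (one_mem_leftOps C)
  | algebraMap c =>
    intro s hs
    rw [Algebra.algebraMap_eq_smul_one, smul_mul_assoc, one_mul]
    simpa using Submodule.smul_mem _ c (Submodule.mul_mem_mul hs (one_mem_leftOps C))
  | add r r' _ _ h h' =>
    intro s hs
    rw [add_mul]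
    exact add_mem (h s hs) (h' s hs)
  | mul r r' _ _ h h' =>
    intro s hs
    have : (N.map (LinearMap.mul F A) * leftOps F C) ≤
        (N.map (LinearMap.mul F A) * leftOps F C).comap (LinearMap.mulLeft F r) := by
      refine Submodule.mul_le.2 fun s hs q hq => ?_
      have := Submodule.mul_mem_mul (h s hs) hq
      rwa [mul_assoc (Submodule.map _ _), leftOps_mul_self, mul_assoc] at this
    rw [mul_assoc]
    exact this (h' s hs)

theorem leftOps_mul_pow_le [IsLeftLeibniz A] {N C : Submodule F A} (hN : IsIdealOf N C) (k : ℕ) :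
    leftOps F C * (N.map (LinearMap.mul F A)) ^ k ≤
      (N.map (LinearMap.mul F A)) ^ k * leftOps F C := by
  induction k with
  | zero => simp
  | succ k ih =>
    rw [pow_succ, ← mul_assoc]
    refine (mul_le_mul' ih le_rfl).trans ?_
    rw [mul_assoc, mul_assoc]
    exact mul_le_mul' le_rfl (leftOps_mul_le hN)

theorem opFiltration_mul_le [IsLeftLeibniz A] {N C : Submodule F A} (hN : IsIdealOf N C)
    (k l : ℕ) : opFiltration N C k * opFiltration N C l ≤ opFiltration N C (k + l) := by
  unfold opFiltration
  calc _ = (N.map (LinearMap.mul F A)) ^ k * (leftOps F C * (N.map (LinearMap.mul F A)) ^ l)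
        * leftOps F C := by simp only [mul_assoc]
    _ ≤ (N.map (LinearMap.mul F A)) ^ k * ((N.map (LinearMap.mul F A)) ^ l * leftOps F C)
        * leftOps F C := mul_le_mul' (mul_le_mul' le_rfl (leftOps_mul_pow_le hN l)) le_rfl
    _ = _ := by rw [pow_add]; simp only [mul_assoc, leftOps_mul_self]

theorem opFiltration_antitone {N C : Submodule F A} (hN : N ≤ C) :
    Antitone (opFiltration N C) := by
  refine antitone_nat_of_succ_le fun k => ?_
  unfold opFiltration
  rw [pow_succ, mul_assoc]
  refine mul_le_mul' le_rfl ((mul_le_mul' (map_mul_le_leftOps hN) le_rfl).trans ?_)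
  rw [leftOps_mul_self]

theorem mul_mem_opFiltration_one {N : Submodule F A} (C : Submodule F A) {x : A} (hx : x ∈ N) :
    LinearMap.mul F A x ∈ opFiltration N C 1 := by
  have := Submodule.mul_mem_mul (Submodule.mem_map_of_mem (f := LinearMap.mul F A) hx)
    (one_mem_leftOps C)
  rwa [mul_one, ← pow_one (Submodule.map _ _)] at this

/-- When `N` is nilpotent its filtration of operators is finite: `C` being an ideal of the whole
algebra, two further left multiplications by elements of `N` bring everything into `N`. -/
theorem exists_opFiltration_eq_bot {N C : Submodule F A} (hC : IsIdealOf C ⊤)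
    (hN : IsIdealOf N C) (nN : IsNilp N) : ∃ m, opFiltration N C m = ⊥ := by
  obtain ⟨m, hm⟩ := nN
  refine ⟨m + 2, (Submodule.eq_bot_iff _).2 fun T hT => ?_⟩
  unfold opFiltration at hT
  rw [pow_add, mul_assoc] at hT
  have hW : ∀ T ∈ (N.map (LinearMap.mul F A)) ^ 2 * leftOps F C, ∀ y, T y ∈ N := by
    intro T hT y
    rw [pow_two, mul_assoc] at hT
    have : (N.map (LinearMap.mul F A)) * ((N.map (LinearMap.mul F A)) * leftOps F C) ≤
        N.comap (LinearMap.applyₗ y) := by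
      refine Submodule.mul_le.2 ?_
      rintro _ ⟨n, hn, rfl⟩ T' hT'
      have h' : (N.map (LinearMap.mul F A)) * leftOps F C ≤ C.comap (LinearMap.applyₗ y) := by
        refine Submodule.mul_le.2 ?_
        rintro _ ⟨n, hn, rfl⟩ T' _
        exact (hC.2 (T' y) trivial n (hN.1 hn)).2
      exact (hN.2 _ (h' hT') n hn).2
    exact this hT
  ext y
  simpa [hm] using apply_mem_lcs hW m T hT y

/-- The derivation `T ↦ a T - T a` of the algebra of operators, `a` acting by left
multiplication. -/
def adLeft (a : A) : Module.End F A →ₗ[F] Module.End F A :=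
  LinearMap.mulLeft F (LinearMap.mul F A a) - LinearMap.mulRight F (LinearMap.mul F A a)

theorem adLeft_mul (a : A) (S T : Module.End F A) :
    adLeft a (S * T) = adLeft a S * T + S * adLeft a T := by
  simp only [adLeft, LinearMap.sub_apply, LinearMap.mulLeft_apply, LinearMap.mulRight_apply]
  noncomm_ring

theorem adLeft_apply_mul [IsLeftLeibniz A] (a x : A) :
    adLeft a (LinearMap.mul F A x) = LinearMap.mul F A (a * x) := by
  simp [adLeft, mul_mul_eq a x]

theorem adLeft_mem_leftOps [IsLeftLeibniz A] {C : Submodule F A} (hC : IsIdealOf C ⊤) (a : A)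
    {r : Module.End F A} (hr : r ∈ leftOps F C) : adLeft a r ∈ leftOps F C := by
  induction hr using Algebra.adjoin_induction with
  | mem r hr =>
    obtain ⟨x, hx, rfl⟩ := hr
    rw [adLeft_apply_mul]
    exact mul_mem_leftOps (hC.2 a trivial x hx).1
  | algebraMap c =>
    have : adLeft a (algebraMap F (Module.End F A) c) = 0 := by
      simp [adLeft, Algebra.commutes c]
    rw [this]
    exact zero_mem _
  | add r r' _ _ h h' =>
    rw [map_add]
    exact add_mem h h'
  | mul r r' hr hr' h h' =>
    rw [adLeft_mul]
    exact add_mem (mul_mem (S := Subalgebra F (Module.End F A)) h hr')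
      (mul_mem (S := Subalgebra F (Module.End F A)) hr h')

theorem adLeft_mem_opFiltration [IsLeftLeibniz A] {N C : Submodule F A} (hC : IsIdealOf C ⊤)
    (hN : IsIdealOf N C) (a : A) (k : ℕ) :
    ∀ T ∈ opFiltration N C k, adLeft a T ∈ opFiltration N C (k - 1) := by
  induction k with
  | zero =>
    intro T hT
    simp only [opFiltration, Nat.zero_sub, pow_zero, one_mul] at hT ⊢
    exact adLeft_mem_leftOps hC a hT
  | succ k ih =>
    have : opFiltration N C (k + 1) ≤ (opFiltration N C k).comap (adLeft a) := by
      conv_lhs => rw [opFiltration, pow_succ', mul_assoc]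
      refine Submodule.mul_le.2 ?_
      rintro _ ⟨n, hn, rfl⟩ T hT
      have hT' : T ∈ opFiltration N C k := hT
      rw [Submodule.mem_comap, adLeft_mul, adLeft_apply_mul]
      refine add_mem ?_ ?_
      · have h0 : LinearMap.mul F A (a * n) ∈ opFiltration N C 0 := by
          simpa [opFiltration] using mul_mem_leftOps (hC.2 a trivial n (hN.1 hn)).1
        simpa using opFiltration_mul_le hN 0 k (Submodule.mul_mem_mul h0 hT')
      · have := opFiltration_mul_le hN 1 (k - 1)
          (Submodule.mul_mem_mul (mul_mem_opFiltration_one C hn) (ih T hT'))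
        exact opFiltration_antitone hN.1 (by omega) this
    exact this

/-! ### Nilpotent ideals of ideals in characteristic zero -/

/-- In characteristic zero, a nilpotent ideal of an ideal stays nilpotent after adding its image
under a left multiplication of the whole algebra. -/
theorem isNilp_sup_map_mul [CharZero F] [IsLeftLeibniz A] {N C : Submodule F A}
    (hC : IsIdealOf C ⊤) (hN : IsIdealOf N C) (nN : IsNilp N) (a : A) :
    IsNilp (N ⊔ N.map (LinearMap.mul F A a)) := by
  obtain ⟨m, hm⟩ := exists_opFiltration_eq_bot hC hN nN
  have hpow := sup_map_pow_le_of_filtration (adLeft_mul a)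
    (by simpa [opFiltration] using one_mem_leftOps C) (opFiltration_antitone hN.1)
    (fun k l x hx y hy => opFiltration_mul_le hN k l (Submodule.mul_mem_mul hx hy))
    (adLeft_mem_opFiltration hC hN a) hm
  have hle : (N ⊔ N.map (LinearMap.mul F A a)).map (LinearMap.mul F A) ≤
      opFiltration N C 1 ⊔ (opFiltration N C 1).map (adLeft a) := by
    rw [Submodule.map_sup]
    refine sup_le_sup ?_ ?_
    · rintro _ ⟨n, hn, rfl⟩
      exact mul_mem_opFiltration_one C hn
    · rintro _ ⟨_, ⟨n, hn, rfl⟩, rfl⟩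
      exact ⟨_, mul_mem_opFiltration_one C hn, adLeft_apply_mul a n⟩
  have hI : ∀ k, opFiltration N C 1 ^ k ≤ opFiltration N C k := fun k => by
    induction k with
    | zero => simpa [opFiltration] using one_mem_leftOps C
    | succ k ih =>
      rw [pow_succ]
      exact (mul_le_mul' ih le_rfl).trans (opFiltration_mul_le hN k 1)
  -- `m` factors land in degree one, and `m` elements of degree one multiply to zero
  refine isNilp_of_pow_eq_bot (k := m * m) (le_bot_iff.1 ?_)
  rw [pow_mul, ← hm]
  exact (pow_le_pow_left' ((pow_le_pow_left' hle m).trans hpow) m).trans (hI m)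

theorem isIdealOf_sup_map_mul [IsLeftLeibniz A] {N C : Submodule F A}
    (hC : IsIdealOf C ⊤) (hN : IsIdealOf N C) (a : A) :
    IsIdealOf (N ⊔ N.map (LinearMap.mul F A a)) C := by
  refine ⟨sup_le hN.1 ?_, fun x hx y hy => ?_⟩
  · rintro _ ⟨n, hn, rfl⟩
    exact (hC.2 a trivial n (hN.1 hn)).1
  · obtain ⟨n, hn, _, ⟨n', hn', rfl⟩, rfl⟩ := Submodule.mem_sup.1 hy
    have hax := (hC.2 a trivial x hx).1
    have e1 : x * (a * n') = a * (x * n') - (a * x) * n' := by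
      rw [IsLeftLeibniz.leibniz a x n']; abel
    have e2 : (a * n') * x = a * (n' * x) - n' * (a * x) := by
      rw [IsLeftLeibniz.leibniz a n' x]; abel
    have hs : ∀ z ∈ N, z ∈ N ⊔ N.map (LinearMap.mul F A a) := fun z hz =>
      Submodule.mem_sup_left hz
    have ht : ∀ z ∈ N, a * z ∈ N ⊔ N.map (LinearMap.mul F A a) := fun z hz =>
      Submodule.mem_sup_right ⟨z, hz, rfl⟩
    simp only [LinearMap.mul_apply', mul_add, add_mul]
    rw [e1, e2]
    exact ⟨add_mem (hs _ (hN.2 x hx n hn).1)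
        (sub_mem (ht _ (hN.2 x hx n' hn').1) (hs _ (hN.2 _ hax n' hn').1)),
      add_mem (hs _ (hN.2 x hx n hn).2)
        (sub_mem (ht _ (hN.2 x hx n' hn').2) (hs _ (hN.2 _ hax n' hn').2))⟩

/-- Sums `x a + a x` act as zero from the left. -/
theorem mul_mul_eq_neg [IsLeftLeibniz A] (x a y : A) : (x * a) * y = -((a * x) * y) := by
  rw [eq_neg_iff_add_eq_zero]
  have h := IsLeftLeibniz.leibniz x a y
  rw [IsLeftLeibniz.leibniz a x y, ← add_assoc] at h
  exact left_eq_add.1 (h.trans (add_comm _ _))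

/-- If `N` is stable under left multiplications by the whole algebra, then adding `N A` to it
does not change the operators by which it acts from the left, because `n a + a n` acts as zero. -/
theorem isNilp_sup_prod_top [IsLeftLeibniz A] {N : Submodule F A}
    (hN : ∀ a : A, ∀ n ∈ N, a * n ∈ N) {m : ℕ}
    (hm : (N.map (LinearMap.mul F A)) ^ m = ⊥) : IsNilp (N ⊔ prod N ⊤) := by
  refine isNilp_of_pow_eq_bot (k := m) (le_bot_iff.1 (hm ▸ pow_le_pow_left' ?_ m))
  refine Submodule.map_le_iff_le_comap.2 (sup_le (Submodule.le_comap_map _ _) ?_)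
  refine prod_le.2 fun n hn a _ => ⟨-(a * n), neg_mem (hN a n hn), ?_⟩
  ext y
  simp [mul_mul_eq_neg n a y]

theorem isIdealOf_sup_prod_top [IsLeftLeibniz A] {N C : Submodule F A} (hC : IsIdealOf C ⊤)
    (hNC : N ≤ C) (hNr : ∀ x ∈ C, ∀ n ∈ N, n * x ∈ N)
    (hN : ∀ a : A, ∀ n ∈ N, a * n ∈ N) : IsIdealOf (N ⊔ prod N ⊤) C := by
  refine ⟨sup_le hNC (prod_le.2 fun n hn a _ => (hC.2 a trivial n (hNC hn)).2),
    fun x hx y hy => ?_⟩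
  have : N ⊔ prod N ⊤ ≤ (N ⊔ prod N ⊤).comap (LinearMap.mulLeft F x) ⊓
      (N ⊔ prod N ⊤).comap (LinearMap.mulRight F x) := by
    refine sup_le (fun n hn => ?_) (prod_le.2 fun n hn a _ => ?_)
    · exact ⟨Submodule.mem_sup_left (hN x n hn), Submodule.mem_sup_left (hNr x hx n hn)⟩
    · refine ⟨?_, ?_⟩
      · change x * (n * a) ∈ N ⊔ prod N ⊤
        rw [IsLeftLeibniz.leibniz]
        exact Submodule.mem_sup_right
          (add_mem (mul_mem_prod (hN x n hn) trivial) (mul_mem_prod hn trivial))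
      · change (n * a) * x ∈ N ⊔ prod N ⊤
        rw [mul_mul_eq_neg]
        exact Submodule.mem_sup_left (neg_mem (hNr x hx _ (hN a n hn)))
  exact this hy

/-- In characteristic zero, a nilpotent ideal of an ideal of `A` is contained in a nilpotent ideal
of `A`: a maximal nilpotent ideal of the ideal containing it does. -/
theorem exists_nilpotent_ideal_of_ideal [CharZero F] [IsLeftLeibniz A] [FiniteDimensional F A]
    {N C : Submodule F A} (hC : IsIdealOf C ⊤) (hN : IsIdealOf N C) (nN : IsNilp N) :
    ∃ N', N ≤ N' ∧ IsIdealOf N' ⊤ ∧ IsNilp N' := by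
  obtain ⟨K, ⟨hNK, hK, nK⟩, hmax⟩ := (wellFounded_gt (α := Submodule F A)).has_min
    {K | N ≤ K ∧ IsIdealOf K C ∧ IsNilp K} ⟨N, le_rfl, hN, nN⟩
  have hmax' : ∀ J, IsIdealOf (K ⊔ J) C → IsNilp (K ⊔ J) → J ≤ K := fun J h h' => by
    by_contra hle
    exact hmax (K ⊔ J) ⟨hNK.trans le_sup_left, h, h'⟩ (left_lt_sup.2 hle)
  have hl : ∀ a : A, ∀ n ∈ K, a * n ∈ K := fun a n hn =>
    hmax' _ (isIdealOf_sup_map_mul hC hK a) (isNilp_sup_map_mul hC hK nK a) ⟨n, hn, rfl⟩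
  obtain ⟨m, hm⟩ := exists_opFiltration_eq_bot hC hK nK
  have hm' : (K.map (LinearMap.mul F A)) ^ m = ⊥ := by
    refine le_bot_iff.1 (hm ▸ ?_)
    simpa [opFiltration] using mul_le_mul' (le_refl ((K.map (LinearMap.mul F A)) ^ m))
      (Submodule.one_le.2 (one_mem_leftOps C))
  have hr := hmax' _ (isIdealOf_sup_prod_top hC hK.1 (fun x hx n hn => (hK.2 x hx n hn).2) hl)
    (isNilp_sup_prod_top hl hm')
  exact ⟨K, hNK, ⟨le_top, fun a _ n hn => ⟨hl a n hn, hr (mul_mem_prod hn trivial)⟩⟩, nK⟩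

/-! ### Subinvariant subalgebras -/

theorem map_lcs {A' : Type*} [NonUnitalNonAssocRing A'] [Module F A'] [IsScalarTower F A' A']
    [SMulCommClass F A' A'] (f : A →ₗ[F] A') (hf : ∀ x y, f (x * y) = f x * f y)
    (U : Submodule F A) (k : ℕ) : (lcs U k).map f = lcs (U.map f) k := by
  induction k with
  | zero => rfl
  | succ k ih =>
    change (prod U (lcs U k)).map f = prod (U.map f) (lcs (U.map f) k)
    rw [← ih]
    refine le_antisymm ?_ ?_
    · refine Submodule.map_le_iff_le_comap.2 (prod_le.2 fun x hx y hy => ?_)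
      rw [Submodule.mem_comap, hf]
      exact mul_mem_prod (Submodule.mem_map_of_mem hx) (Submodule.mem_map_of_mem hy)
    · refine prod_le.2 ?_
      rintro _ ⟨x, hx, rfl⟩ _ ⟨y, hy, rfl⟩
      exact ⟨x * y, mul_mem_prod hx hy, hf x y⟩

instance [IsLeftLeibniz A] (B : NonUnitalSubalgebra F A) : IsLeftLeibniz B where
  leibniz x y z := Subtype.ext (IsLeftLeibniz.leibniz (x : A) y z)

theorem exists_nilpotent_ideal_of_ideal_subalgebra [CharZero F] [IsLeftLeibniz A]
    [FiniteDimensional F A] {N C : Submodule F A} {B : NonUnitalSubalgebra F A}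
    (hC : IsIdealOf C B.toSubmodule) (hN : IsIdealOf N C) (nN : IsNilp N) :
    ∃ N', N ≤ N' ∧ IsIdealOf N' B.toSubmodule ∧ IsNilp N' := by
  let f : B →ₗ[F] A := B.toSubmodule.subtype
  have hf : ∀ x y : B, f (x * y) = f x * f y := fun _ _ => rfl
  have hinj : Function.Injective f := Subtype.val_injective
  have hNB : (N.comap f).map f = N :=
    Submodule.map_comap_eq_of_le ((hN.1.trans hC.1).trans (Submodule.range_subtype _).ge)
  have : FiniteDimensional F B := inferInstanceAs (FiniteDimensional F B.toSubmodule)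
  obtain ⟨N', hle, hid, m, hm⟩ := exists_nilpotent_ideal_of_ideal
    (N := N.comap f) (C := C.comap f) ⟨le_top, fun x _ y hy => hC.2 x x.2 y hy⟩
    ⟨Submodule.comap_mono hN.1, fun x hx y hy => hN.2 x hx y hy⟩ (by
      obtain ⟨m, hm⟩ := nN
      refine ⟨m, Submodule.map_injective_of_injective hinj ?_⟩
      rw [map_lcs f hf, hNB, hm, Submodule.map_bot])
  refine ⟨N'.map f, hNB ▸ Submodule.map_mono hle, ⟨?_, ?_⟩, m, ?_⟩
  · rintro _ ⟨y, _, rfl⟩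
    exact y.2
  · rintro x hx _ ⟨y, hy, rfl⟩
    have := hid.2 ⟨x, hx⟩ trivial y hy
    exact ⟨⟨_, this.1, rfl⟩, ⟨_, this.2, rfl⟩⟩
  · rw [← map_lcs f hf, hm, Submodule.map_bot]

theorem le_nilrad_of_isSubinvariant [CharZero F] [IsLeftLeibniz A] [FiniteDimensional F A]
    {M : NonUnitalSubalgebra F A} (nM : IsNilp M.toSubmodule) (hM : IsSubinvariant M) :
    M.toSubmodule ≤ nilrad F A := by
  obtain ⟨t, c, h0, ht, hc⟩ := hM
  -- climbing the chain, `M` lies in a nilpotent ideal of each of its terms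
  have key : ∀ i ≤ t, ∃ N, M.toSubmodule ≤ N ∧ IsIdealOf N (c (t - i)).toSubmodule ∧ IsNilp N := by
    intro i
    induction i with
    | zero =>
      intro _
      refine ⟨M.toSubmodule, le_rfl, ?_, nM⟩
      rw [Nat.sub_zero, ht]
      exact ⟨le_rfl, fun x hx y hy => ⟨M.mul_mem hx hy, M.mul_mem hy hx⟩⟩
    | succ i ih =>
      intro hi
      obtain ⟨N, hMN, hN, nN⟩ := ih (by omega)
      have hci := hc (t - (i + 1)) (by omega)
      rw [show t - (i + 1) + 1 = t - i by omega] at hci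
      obtain ⟨N', h, h', h''⟩ := exists_nilpotent_ideal_of_ideal_subalgebra hci hN nN
      exact ⟨N', hMN.trans h, h', h''⟩
  obtain ⟨N, hMN, hN, nN⟩ := key t le_rfl
  rw [Nat.sub_self, h0] at hN
  exact hMN.trans (le_sSup ⟨by simpa using hN, nN⟩)

end Leibniz
end LeibnizAlg

namespace LeibnizAlg

open Polynomial

/-! ### The Lie algebra of a derivation acting on a cross product algebra -/

section CrossDer

variable {F R : Type*} [Field F] [CommRing R] [Algebra F R]

/-- The Lie algebra `R³ ⋊ F d`, where `R³` carries the cross product over the commutative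
`F`-algebra `R` (so that it is a form of `𝔰𝔩₂ ⊗ R` when `2` is invertible) and the derivation `d`
of `R` acts on it componentwise. The element with components `vec` and `der` stands for
`vec + der • d`. -/
@[ext]
structure CrossDer (d : Derivation F R R) where
  vec : Fin 3 → R
  der : F

namespace CrossDer

variable (d : Derivation F R R)

/-- The vector space structure is transported from the product along this bijection. -/
def equivProd : CrossDer d ≃ (Fin 3 → R) × F where
  toFun x := (x.vec, x.der)
  invFun x := ⟨x.1, x.2⟩
  left_inv _ := rfl
  right_inv _ := rfl

instance : AddCommGroup (CrossDer d) := (equivProd d).addCommGroup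

instance : Module F (CrossDer d) := (equivProd d).module F

instance [Module.Finite F R] : FiniteDimensional F (CrossDer d) :=
  Module.Finite.equiv ((equivProd d).linearEquiv F).symm

instance : Mul (CrossDer d) where
  mul x y := ⟨crossProduct x.vec y.vec + x.der • (fun i => d (y.vec i))
    - y.der • (fun i => d (x.vec i)), 0⟩

variable {d}

@[simp] theorem add_vec (x y : CrossDer d) : (x + y).vec = x.vec + y.vec := rfl

@[simp] theorem add_der (x y : CrossDer d) : (x + y).der = x.der + y.der := rfl

@[simp] theorem smul_vec (c : F) (x : CrossDer d) : (c • x).vec = c • x.vec := rfl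

@[simp] theorem smul_der (c : F) (x : CrossDer d) : (c • x).der = c * x.der := rfl

@[simp] theorem zero_vec : (0 : CrossDer d).vec = 0 := rfl

@[simp] theorem zero_der : (0 : CrossDer d).der = 0 := rfl

@[simp] theorem mul_vec_zero (x y : CrossDer d) : (x * y).vec 0 =
    x.vec 1 * y.vec 2 - x.vec 2 * y.vec 1 + x.der • d (y.vec 0) - y.der • d (x.vec 0) := rfl

@[simp] theorem mul_vec_one (x y : CrossDer d) : (x * y).vec 1 =
    x.vec 2 * y.vec 0 - x.vec 0 * y.vec 2 + x.der • d (y.vec 1) - y.der • d (x.vec 1) := rfl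

@[simp] theorem mul_vec_two (x y : CrossDer d) : (x * y).vec 2 =
    x.vec 0 * y.vec 1 - x.vec 1 * y.vec 0 + x.der • d (y.vec 2) - y.der • d (x.vec 2) := rfl

@[simp] theorem mul_der (x y : CrossDer d) : (x * y).der = 0 := rfl

theorem ext_coord {x y : CrossDer d} (h0 : x.vec 0 = y.vec 0) (h1 : x.vec 1 = y.vec 1)
    (h2 : x.vec 2 = y.vec 2) (h : x.der = y.der) : x = y := by
  refine CrossDer.ext (funext fun i => ?_) h
  fin_cases i <;> assumption

instance : NonUnitalNonAssocRing (CrossDer d) where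
  left_distrib x y z := by
    apply ext_coord <;> simp <;> simp only [Algebra.smul_def, map_add] <;> ring
  right_distrib x y z := by
    apply ext_coord <;> simp <;> simp only [Algebra.smul_def, map_add] <;> ring
  zero_mul x := by apply ext_coord <;> simp
  mul_zero x := by apply ext_coord <;> simp

instance : IsScalarTower F (CrossDer d) (CrossDer d) where
  smul_assoc c x y := by
    apply ext_coord <;> simp <;> simp only [Algebra.smul_def, map_mul] <;> ring

instance : SMulCommClass F (CrossDer d) (CrossDer d) where
  smul_comm c x y := by
    apply ext_coord <;> simp <;> simp only [Algebra.smul_def, map_mul] <;> ring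

theorem mul_self_eq_zero (x : CrossDer d) : x * x = 0 := by
  apply ext_coord <;> simp [mul_comm]

instance : IsLeftLeibniz (CrossDer d) where
  leibniz x y z := by
    apply ext_coord <;> simp <;> simp only [Algebra.smul_def] <;> ring

/-- The subalgebra `I³` of `R³`, for an ideal `I` of `R`. -/
def ofIdeal (d : Derivation F R R) (I : Ideal R) : NonUnitalSubalgebra F (CrossDer d) where
  carrier := {x | (∀ i, x.vec i ∈ I) ∧ x.der = 0}
  add_mem' {x y} hx hy := ⟨fun i => add_mem (hx.1 i) (hy.1 i), by simp [hx.2, hy.2]⟩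
  zero_mem' := ⟨fun i => zero_mem I, rfl⟩
  mul_mem' {x y} hx hy := by
    refine ⟨fun i => ?_, rfl⟩
    have h : ∀ j k, x.vec j * y.vec k ∈ I := fun j k => I.mul_mem_left _ (hy.1 k)
    fin_cases i <;> simp [hx.2, hy.2] <;> exact sub_mem (h _ _) (h _ _)
  smul_mem' c x hx := ⟨fun i => by
    rw [smul_vec, Pi.smul_apply, Algebra.smul_def]
    exact I.mul_mem_left _ (hx.1 i), by simp [hx.2]⟩

/-- `I³` is an ideal of `R³`, which is an ideal of `R³ ⋊ F d`. -/
theorem isSubinvariant_ofIdeal (I : Ideal R) : IsSubinvariant (ofIdeal d I) := by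
  refine ⟨2, fun i => match i with | 0 => ⊤ | 1 => ofIdeal d ⊤ | _ => ofIdeal d I, rfl, rfl, ?_⟩
  intro i hi
  interval_cases i
  · exact ⟨by simp, fun x _ y _ => ⟨⟨fun _ => trivial, rfl⟩, ⟨fun _ => trivial, rfl⟩⟩⟩
  · refine ⟨fun x hx => ⟨fun _ => trivial, hx.2⟩, fun x hx y hy => ⟨⟨fun i => ?_, rfl⟩,
      ⟨fun i => ?_, rfl⟩⟩⟩
    · have h : ∀ j k, x.vec j * y.vec k ∈ I := fun j k => I.mul_mem_left _ (hy.1 k)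
      fin_cases i <;> simp [hx.2, hy.2] <;> exact sub_mem (h _ _) (h _ _)
    · have h : ∀ j k, y.vec j * x.vec k ∈ I := fun j k => I.mul_mem_right _ (hy.1 j)
      fin_cases i <;> simp [hx.2, hy.2] <;> exact sub_mem (h _ _) (h _ _)

theorem lcs_ofIdeal_le (I : Ideal R) (k : ℕ) :
    lcs (ofIdeal d I).toSubmodule k ≤ (ofIdeal d (I ^ (k + 1))).toSubmodule := by
  induction k with
  | zero =>
    rw [zero_add, pow_one]
    exact le_rfl
  | succ k ih =>
    refine prod_le.2 fun x hx y hy => ⟨fun i => ?_, rfl⟩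
    have hy' := ih hy
    have h : ∀ j k', x.vec j * y.vec k' ∈ I ^ (k + 1 + 1) := fun j k' => by
      rw [pow_succ' I (k + 1)]
      exact Ideal.mul_mem_mul (hx.1 j) (hy'.1 k')
    fin_cases i <;> simp [hx.2, hy'.2] <;> exact sub_mem (h _ _) (h _ _)

theorem isNilp_ofIdeal {I : Ideal R} {n : ℕ} (hI : I ^ n = ⊥) :
    IsNilp (ofIdeal d I).toSubmodule := by
  refine ⟨n, le_bot_iff.1 ((lcs_ofIdeal_le I n).trans fun x hx => ?_)⟩
  rw [pow_succ, hI, Ideal.bot_mul] at hx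
  exact (Submodule.mem_bot F).2 (ext_coord (hx.1 0) (hx.1 1) (hx.1 2) hx.2)

/-- The element `r eᵢ` of `R³`. -/
def single (d : Derivation F R R) (i : Fin 3) (r : R) : CrossDer d := ⟨Pi.single i r, 0⟩

theorem single_mul_single (i : Fin 3) (r s : R) :
    single d i r * single d (i + 1) s = single d (i + 2) (r * s) := by
  fin_cases i <;> apply ext_coord <;> simp [single]

theorem single_mul_single_mul (i : Fin 3) {y : CrossDer d} (hy : y.der = 0) :
    single d i 1 * (single d (i + 1) 1 * y) = single d (i + 1) (y.vec i) := by
  fin_cases i <;> apply ext_coord <;> simp [single, hy]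

theorem single_add (i : Fin 3) (r s : R) : single d i (r + s) = single d i r + single d i s := by
  apply CrossDer.ext <;> simp [single, Pi.single_add]

theorem single_zero (i : Fin 3) : single d i 0 = 0 := by
  apply CrossDer.ext <;> simp [single]

/-- For an ideal `J` of `R³ ⋊ F d`, the ideal of those `r` for which `J` contains the `r eᵢ`. -/
def coeffIdeal {J : Submodule F (CrossDer d)} (hJ : IsIdealOf J ⊤) : Ideal R where
  carrier := {r | ∀ i, single d i r ∈ J}
  add_mem' hr hs i := by
    rw [single_add]
    exact add_mem (hr i) (hs i)
  zero_mem' i := by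
    rw [single_zero]
    exact zero_mem J
  smul_mem' c r hr i := by
    have h := (hJ.2 (single d (i + 1) c) trivial _ (hr (i + 1 + 1))).1
    rwa [single_mul_single, show i + 1 + 2 = i by fin_cases i <;> rfl] at h

/-- One unit vector suffices: multiplying by the others permutes the coordinates cyclically. -/
theorem mem_coeffIdeal {J : Submodule F (CrossDer d)} (hJ : IsIdealOf J ⊤) {i : Fin 3} {r : R}
    (h : single d i r ∈ J) : r ∈ coeffIdeal hJ := by
  have step : ∀ j, single d j r ∈ J → single d (j + 2) r ∈ J := fun j hj => by
    have := (hJ.2 (single d (j + 1) 1) trivial _ hj).2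
    rwa [single_mul_single, mul_one] at this
  have h1 := step _ h
  have h2 := step _ h1
  intro j
  fin_cases i <;> fin_cases j <;> first | exact h | exact h1 | exact h2

theorem der_mem_coeffIdeal {J : Submodule F (CrossDer d)} (hJ : IsIdealOf J ⊤) {r : R}
    (h : r ∈ coeffIdeal hJ) : d r ∈ coeffIdeal hJ := fun i => by
  -- the element `⟨0, 1⟩` is `d` itself
  have := (hJ.2 ⟨0, 1⟩ trivial _ (h i)).1
  convert this using 1
  fin_cases i <;> apply ext_coord <;> simp [single]

/-- A nonzero ideal contains a nonzero `v ∈ R³`, and then `eᵢ × (eᵢ₊₁ × v) = vᵢ eᵢ₊₁`. -/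
theorem coeffIdeal_ne_bot {t : R} (ht : d t = 1) [Nontrivial R] {J : Submodule F (CrossDer d)}
    (hJ : IsIdealOf J ⊤) (hne : J ≠ ⊥) : coeffIdeal hJ ≠ ⊥ := by
  obtain ⟨x, hx, hx0⟩ := Submodule.exists_mem_ne_zero_of_ne_bot hne
  obtain ⟨y, hy, hy2, i, hi⟩ : ∃ y ∈ J, y.der = 0 ∧ ∃ i, y.vec i ≠ 0 := by
    by_cases hs : x.der = 0
    · refine ⟨x, hx, hs, ?_⟩
      by_contra! h
      exact hx0 (ext_coord (h 0) (h 1) (h 2) hs)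
    -- multiplying `v + s d` by `t e₀` leaves `s` as the zeroth coordinate
    · refine ⟨x * single d 0 t, (hJ.2 _ trivial x hx).2, rfl, 0, ?_⟩
      simpa [single, ht, Algebra.smul_def] using hs
  refine (Submodule.ne_bot_iff _).2 ⟨y.vec i, mem_coeffIdeal hJ (i := i + 1) ?_, hi⟩
  rw [← single_mul_single_mul i hy2]
  exact (hJ.2 _ trivial _ (hJ.2 _ trivial y hy).1).1

theorem single_one_mem_lcs {J : Submodule F (CrossDer d)} (h : ∀ i, single d i 1 ∈ J) (k : ℕ) :
    ∀ i, single d i 1 ∈ lcs J k := by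
  induction k with
  | zero => exact h
  | succ k ih =>
    intro i
    have := mul_mem_prod (h (i + 1)) (ih (i + 1 + 1))
    rwa [single_mul_single, mul_one, show i + 1 + 2 = i by fin_cases i <;> rfl] at this

/-- If `R` has no nontrivial ideals stable under `d`, then `R³ ⋊ F d` has no nonzero nilpotent
ideals: a nonzero ideal contains the basis vectors `eᵢ`, which span a perfect subalgebra. -/
theorem nilrad_eq_bot [Nontrivial R] {t : R} (ht : d t = 1)
    (hd : ∀ K : Ideal R, (∀ r ∈ K, d r ∈ K) → K ≠ ⊥ → K = ⊤) : nilrad F (CrossDer d) = ⊥ := by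
  refine sSup_eq_bot.2 fun J ⟨hJ, m, hm⟩ => ?_
  by_contra hne
  have htop := hd _ (fun r hr => der_mem_coeffIdeal hJ hr) (coeffIdeal_ne_bot ht hJ hne)
  have h1 : (1 : R) ∈ coeffIdeal hJ := htop ▸ trivial
  have h0 := single_one_mem_lcs h1 m 0
  rw [hm, Submodule.mem_bot] at h0
  exact one_ne_zero (congrFun (congrArg vec h0) 0)

end CrossDer
end CrossDer

/-! ### Truncated polynomial algebras -/

section TruncPoly

variable (F : Type*) [Field F] (p : ℕ)

/-- The truncated polynomial algebra `F[X] / (X ^ p)`. -/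
abbrev TruncPoly : Type _ := F[X] ⧸ Ideal.span {(X : F[X]) ^ p}

namespace TruncPoly

instance : Module.Finite F (TruncPoly F p) := (monic_X_pow p).finite_quotient

theorem nontrivial [NeZero p] : Nontrivial (TruncPoly F p) := by
  rw [Ideal.Quotient.nontrivial_iff, Ne, Ideal.span_singleton_eq_top]
  exact fun h => not_isUnit_X ((isUnit_pow_iff (NeZero.ne p)).1 h)

/-- The derivation `d/dX` of `F[X] / (X ^ p)`, which exists because `(X ^ p)' = p X ^ (p - 1)`
vanishes in characteristic `p`. -/
noncomputable def der [CharP F p] : Derivation F (TruncPoly F p) (TruncPoly F p) :=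
  Derivation.liftOfSurjective (d := derivative')
    (f := Ideal.Quotient.mkₐ F (Ideal.span {(X : F[X]) ^ p}))
    (Ideal.Quotient.mkₐ_surjective F _) (by
      intro x hx
      rw [Ideal.Quotient.mkₐ_eq_mk, Ideal.Quotient.eq_zero_iff_mem,
        Ideal.mem_span_singleton] at hx ⊢
      obtain ⟨y, rfl⟩ := hx
      simp [derivative'])

theorem der_mk [CharP F p] (f : F[X]) :
    der F p (Ideal.Quotient.mk _ f) = Ideal.Quotient.mk _ (derivative f) := by
  rw [← Ideal.Quotient.mkₐ_eq_mk F, der, Derivation.liftOfSurjective_apply]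
  rfl

variable {F p}

/-- Differentiating lowers the degree of a polynomial of degree less than `p` by exactly one, until
a nonzero constant is reached. -/
theorem one_mem_of_der_mem [CharP F p] {K : Ideal (TruncPoly F p)}
    (hK : ∀ r ∈ K, der F p r ∈ K) (n : ℕ) : ∀ f : F[X], f.natDegree = n → n < p → f ≠ 0 →
      Ideal.Quotient.mk _ f ∈ K → (1 : TruncPoly F p) ∈ K := by
  induction n with
  | zero =>
    intro f hf _ hf0 hfK
    rw [natDegree_eq_zero] at hf
    obtain ⟨c, rfl⟩ := hf
    have hc : c ≠ 0 := fun h => hf0 (by simp [h])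
    have := K.mul_mem_left (Ideal.Quotient.mk _ (C c⁻¹)) hfK
    rwa [← map_mul, ← C_mul, inv_mul_cancel₀ hc, C_1, map_one] at this
  | succ n ih =>
    intro f hf hn hf0 hfK
    have hcast : ((n + 1 : ℕ) : F) ≠ 0 := fun h =>
      absurd (Nat.le_of_dvd n.succ_pos ((CharP.cast_eq_zero_iff F p _).1 h)) (by omega)
    have hcoeff : (derivative f).coeff n ≠ 0 := by
      rw [coeff_derivative, ← Nat.cast_succ]
      refine mul_ne_zero ?_ hcast
      rw [← hf]
      exact leadingCoeff_ne_zero.2 hf0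
    have hdeg : (derivative f).natDegree = n :=
      le_antisymm ((natDegree_derivative_le f).trans (by omega)) (le_natDegree_of_ne_zero hcoeff)
    refine ih (derivative f) hdeg (by omega) (fun h => hcoeff (by simp [h])) ?_
    rw [← der_mk]
    exact hK _ hfK

/-- The only ideals of `F[X] / (X ^ p)` stable under `d/dX` are the trivial ones. -/
theorem eq_top_of_der_mem [CharP F p] (K : Ideal (TruncPoly F p))
    (hK : ∀ r ∈ K, der F p r ∈ K) (hne : K ≠ ⊥) : K = ⊤ := by
  obtain ⟨r, hr, hr0⟩ := Submodule.exists_mem_ne_zero_of_ne_bot hne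
  obtain ⟨f, rfl⟩ := Ideal.Quotient.mk_surjective r
  have hm := monic_X_pow (R := F) p
  have hmod : Ideal.Quotient.mk (Ideal.span {(X : F[X]) ^ p}) (f %ₘ X ^ p) =
      Ideal.Quotient.mk _ f := by
    rw [Ideal.Quotient.eq, Ideal.mem_span_singleton, modByMonic_eq_sub_mul_div f]
    exact ⟨-(f /ₘ X ^ p), by ring⟩
  have hf0 : f %ₘ X ^ p ≠ 0 := fun h => hr0 (by rw [← hmod, h, map_zero])
  have hp : (X ^ p : F[X]) ≠ 1 := fun h => hf0 (by rw [h, modByMonic_one])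
  have hlt := natDegree_modByMonic_lt f hm hp
  rw [natDegree_X_pow] at hlt
  exact (Ideal.eq_top_iff_one K).2 (one_mem_of_der_mem hK _ _ rfl hlt hf0 (by rwa [hmod]))

end TruncPoly
end TruncPoly
end LeibnizAlg

/-! ### Nilpotent subinvariant subalgebras and the nilradical -/

open LeibnizAlg Polynomial in
theorem mainTheorem3 :
    (∀ (F : Type u) [Field F] [CharZero F]
      (A : Type v) [NonUnitalNonAssocRing A] [Module F A] [IsScalarTower F A A]
      [SMulCommClass F A A] [IsLeftLeibniz A] [FiniteDimensional F A]
      (M : NonUnitalSubalgebra F A),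
      LeibnizAlg.IsNilp M.toSubmodule → LeibnizAlg.IsSubinvariant M →
        M.toSubmodule ≤ LeibnizAlg.nilrad F A) ∧
    (∀ (p : ℕ) (_ : p.Prime) (_ : 2 < p) (F : Type u) [Field F] [CharP F p],
      ∃ (P : Type u) (_ : NonUnitalNonAssocRing P) (_ : Module F P) (_ : IsScalarTower F P P)
        (_ : SMulCommClass F P P) (_ : IsLeftLeibniz P) (_ : FiniteDimensional F P),
        (∀ x : P, x * x = 0) ∧
        ∃ M : NonUnitalSubalgebra F P,
          LeibnizAlg.IsNilp M.toSubmodule ∧ LeibnizAlg.IsSubinvariant M ∧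
            LeibnizAlg.nilrad F P = ⊥ ∧ ¬ M.toSubmodule ≤ LeibnizAlg.nilrad F P) := by
  refine ⟨fun F _ _ A _ _ _ _ _ _ M nM hM => le_nilrad_of_isSubinvariant nM hM,
    fun p hp hp2 F _ _ => ?_⟩
  have : NeZero p := ⟨hp.ne_zero⟩
  have := TruncPoly.nontrivial F p
  let x : TruncPoly F p := Ideal.Quotient.mk _ X
  have hx : TruncPoly.der F p x = 1 := by
    rw [TruncPoly.der_mk, derivative_X, map_one]
  have hxp : Ideal.span {x} ^ p = ⊥ := by
    rw [Ideal.span_singleton_pow, Ideal.span_singleton_eq_bot, ← map_pow,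
      Ideal.Quotient.eq_zero_iff_mem]
    exact Ideal.mem_span_singleton_self _
  have hnil := CrossDer.nilrad_eq_bot hx TruncPoly.eq_top_of_der_mem
  refine ⟨CrossDer (TruncPoly.der F p), inferInstance, inferInstance, inferInstance,
    inferInstance, inferInstance, inferInstance, CrossDer.mul_self_eq_zero,
    CrossDer.ofIdeal _ (Ideal.span {x}), CrossDer.isNilp_ofIdeal hxp,
    CrossDer.isSubinvariant_ofIdeal _, hnil, ?_⟩
  rw [hnil, le_bot_iff]
  intro h
  have hmem : CrossDer.single (TruncPoly.der F p) 0 x ∈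
      (CrossDer.ofIdeal _ (Ideal.span {x})).toSubmodule := by
    refine ⟨fun i => ?_, rfl⟩
    fin_cases i <;> simp [CrossDer.single]
  rw [h, Submodule.mem_bot] at hmem
  have hx0 : x = 0 := congrFun (congrArg CrossDer.vec hmem) 0
  rw [hx0, map_zero] at hx
  exact zero_ne_one hx
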